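/- Let $k=\mathbf{F}_q$ be a finite field with $q$ elements. For a scheme $X$ of finite type over $k$ let $$Z(X,t)=\exp\Big(\sum_{m\ge 1}\mathrm{card}\,X(\mathbf{F}_{q^m})\,\frac{t^m}{m}\Big)$$ be its Hasse–Weil zeta function. To each effective zero-cycle $\alpha=\sum_x a_x\,x$ on $X$ (a finite sum over closed points, $a_x\in\mathbf{Z}_{\ge 0}$, with $\deg\alpha=\sum_x a_x[\kappa(x):k]$) assign the weight $P(\alpha)=t^{\deg\alpha}/Z(X,t)$, and let $S(X,s)=-\sum_\alpha P(\alpha)\log P(\alpha)$ at $t=q^{-s}$ be the associated Shannon entropy. A physical system is given by its states and their energies; an energy level has degeneracy $D$ if $D$ states have that energy. Its partition function is $Z(\beta)=\sum_{\text{states }x}e^{-\beta E(x)}$, and its thermodynamical entropy at inverse temperature $\beta$ is $\big(1-\beta\frac{d}{d\beta}\big)\log Z(\beta)$. The states of a composite of finitely many independent systems are the tuples of states of the subsystems, and energies add. Let $s$ be a real number with $s>0$ in (a), and let $n\ge 0$ be an integer and $s>n$ real in (b) and (c). In each case the series defining $Z(X,q^{-s})$ converges, the weights $P(\alpha)$ form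 a probability distribution, the entropy series converges, the partition function of the indicated system converges at $\beta=s$ to a positive number, and all the functions to which $\frac{d}{ds}$ or $\frac{d}{d\beta}$ is applied are differentiable at $s$. Moreover: (a) $S(\mathrm{Spec}\,\mathbf{F}_q,s)=-\big(1-s\frac{d}{ds}\big)\log(1-q^{-s})$, and this is the thermodynamical entropy at $\beta=s$ of the system with non-degenerate energy levels $\{j\log q\}_{j\ge 0}$. (b) $S(\mathbf{A}^n_{\mathbf{F}_q},s)=-\big(1-s\frac{d}{ds}\big)\log(1-q^{n-s})$, and this is the thermodynamical entropy at $\beta=s$ of the system with energy levels $\{j\log q\}_{j\ge 0}$, the level $j\log q$ having degeneracy $q^{jn}$. (c) $S(\mathbf{P}^n_{\mathbf{F}_q},s)=-\big(1-s\frac{d}{ds}\big)\sum_{i=0}^n\log(1-q^{i-s})$, and this is the thermodynamical entropy at $\beta=s$ of the composite of $n+1$ independent systems, indexed by $i=0,\dots,n$, each with energy levels $\{j\log q\}_{j\ge 0}$, where in the $i$-th system the level $j\log q$ has degeneracy $q^{ji}$. -/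

import Mathlib

open CategoryTheory AlgebraicGeometry

namespace ZetaEntropy

noncomputable section

/-! ## Zero-cycles, the Hasse-Weil zeta function and its Shannon entropy

Throughout, `k` is a finite field of characteristic `p`, and a scheme over `k` is given by its
structure morphism `f : X ⟶ Spec k`. -/

/-- Effective zero-cycles on a scheme `X`: finite formal sums of closed points of `X` with
nonnegative integer multiplicities. -/
abbrev EffectiveZeroCycle (X : Scheme.{0}) : Type :=
  (closedPoints X) →₀ ℕ

/-- The degree `∑ₓ α(x) [κ(x) : k]` of an effective zero-cycle on a scheme over `k`. -/
def zeroCycleDegree {k : Type} [Field k] {X : Scheme.{0}} (f : X ⟶ Spec (.of k))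
    (α : EffectiveZeroCycle X) : ℕ :=
  α.sum fun x a => a * f.residueDegree x.1

/-- `X(K)`: the points of the `k`-scheme `X` with values in a field extension `K` of `k`. -/
def RationalPoints {k : Type} [Field k] {X : Scheme.{0}} (f : X ⟶ Spec (.of k))
    (K : Type) [Field K] [Algebra k K] : Type :=
  {g : Spec (.of K) ⟶ X // g ≫ f = Spec.map (CommRingCat.ofHom (algebraMap k K))}

/-- The term `card X(𝔽_{q^m}) t^m / m` of the Hasse-Weil series, where `𝔽_{q^m}` is the extension
of degree `m` of `k`. -/
def zetaTerm (p : ℕ) [Fact p.Prime] {k : Type} [Field k] [Finite k] [CharP k p]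
    {X : Scheme.{0}} (f : X ⟶ Spec (.of k)) (t : ℝ) (m : ℕ) [NeZero m] : ℝ :=
  (Nat.card (RationalPoints f (FiniteField.Extension k p m)) : ℝ) * t ^ m / m

/-- The Hasse-Weil zeta function `Z(X, t) = exp (∑_{m ≥ 1} card X(𝔽_{q^m}) t^m / m)`. -/
def hasseWeilZeta (p : ℕ) [Fact p.Prime] {k : Type} [Field k] [Finite k] [CharP k p]
    {X : Scheme.{0}} (f : X ⟶ Spec (.of k)) (t : ℝ) : ℝ :=
  Real.exp (∑' m : ℕ, zetaTerm p f t (m + 1))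

/-- The weight `P(α) = t ^ deg α / Z(X, t)` of an effective zero-cycle `α`. -/
def cycleProb (p : ℕ) [Fact p.Prime] {k : Type} [Field k] [Finite k] [CharP k p]
    {X : Scheme.{0}} (f : X ⟶ Spec (.of k)) (t : ℝ) (α : EffectiveZeroCycle X) : ℝ :=
  t ^ zeroCycleDegree f α / hasseWeilZeta p f t

/-- The Shannon entropy `S(X, s) = - ∑_α P(α) log P(α)` at `t = q ^ (-s)`, `q = card k`. -/
def shannonEntropy (p : ℕ) [Fact p.Prime] {k : Type} [Field k] [Finite k] [CharP k p]
    {X : Scheme.{0}} (f : X ⟶ Spec (.of k)) (s : ℝ) : ℝ :=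
  -∑' α : EffectiveZeroCycle X,
    cycleProb p f ((Nat.card k : ℝ) ^ (-s)) α * Real.log (cycleProb p f ((Nat.card k : ℝ) ^ (-s)) α)

/-- The definition of `S(X, s)` is meaningful at `s`: the series defining `Z(X, q ^ (-s))`
converges, the weights `P(α)` form a probability distribution, and the entropy series converges. -/
structure HasShannonEntropyAt (p : ℕ) [Fact p.Prime] {k : Type} [Field k] [Finite k] [CharP k p]
    {X : Scheme.{0}} (f : X ⟶ Spec (.of k)) (s : ℝ) : Prop where
  summable_zeta : Summable fun m : ℕ => zetaTerm p f ((Nat.card k : ℝ) ^ (-s)) (m + 1)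
  prob_nonneg : ∀ α, 0 ≤ cycleProb p f ((Nat.card k : ℝ) ^ (-s)) α
  hasSum_prob : HasSum (cycleProb p f ((Nat.card k : ℝ) ^ (-s))) 1
  summable_entropy : Summable fun α : EffectiveZeroCycle X =>
    cycleProb p f ((Nat.card k : ℝ) ^ (-s)) α *
      Real.log (cycleProb p f ((Nat.card k : ℝ) ^ (-s)) α)

/-! ## The schemes -/

attribute [local instance] MvPolynomial.gradedAlgebra

/-- The structure morphism of affine space `𝔸ⁿ` over `k`. -/
def affineSpaceHom (k : Type) [Field k] (n : ℕ) :
    𝔸(Fin n; Spec (.of k)) ⟶ Spec (.of k) :=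
  𝔸(Fin n; Spec (.of k)) ↘ Spec (.of k)

/-- Projective space `ℙⁿ = Proj k[x₀, …, xₙ]` over `k`, for the grading by total degree. -/
def projectiveSpace (k : Type) [Field k] (n : ℕ) : Scheme.{0} :=
  Proj (MvPolynomial.homogeneousSubmodule (Fin (n + 1)) k)

/-- The structure morphism of projective space over `k`. -/
def projectiveSpaceHom (k : Type) [Field k] (n : ℕ) : projectiveSpace k n ⟶ Spec (.of k) :=
  Proj.toSpecZero (MvPolynomial.homogeneousSubmodule (Fin (n + 1)) k) ≫
    Spec.map (CommRingCat.ofHom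
      (algebraMap k (MvPolynomial.homogeneousSubmodule (Fin (n + 1)) k 0)))

/-! ## Thermodynamics -/

/-- The operator `1 - s d/ds`, applied to `g` and evaluated at `s`. -/
def oneSubEuler (g : ℝ → ℝ) (s : ℝ) : ℝ :=
  g s - s * deriv g s

/-- A physical system whose Hamiltonian is diagonal in a basis of states: the states of the basis
together with their energies (the eigenvalues, repeated according to multiplicity). -/
structure PhysicalSystem where
  /-- the basis of states -/
  State : Type
  /-- the energy of a state -/
  energy : State → ℝ

namespace PhysicalSystem

/-- The system with energy levels `E j`, `j ≥ 0`, where the `j`-th level has degeneracy `D j`. -/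
def ofLevels (E : ℕ → ℝ) (D : ℕ → ℕ) : PhysicalSystem where
  State := Σ j : ℕ, Fin (D j)
  energy x := E x.1

/-- The composite of finitely many independent (non-interacting) systems: a state is a tuple of
states of the subsystems, and energies add up. -/
def composite {ι : Type} [Fintype ι] (Y : ι → PhysicalSystem) : PhysicalSystem where
  State := ∀ i, (Y i).State
  energy x := ∑ i, (Y i).energy (x i)

/-- The partition function `Z(β) = Tr (e ^ (-β H))`. -/
def partitionFunction (Y : PhysicalSystem) (β : ℝ) : ℝ :=
  ∑' x : Y.State, Real.exp (-β * Y.energy x)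

/-- The thermodynamical entropy `(1 - β ∂/∂β) log Z(β)` at inverse temperature `β`. -/
def entropy (Y : PhysicalSystem) (β : ℝ) : ℝ :=
  oneSubEuler (fun b => Real.log (Y.partitionFunction b)) β

/-- The thermodynamical entropy is meaningful at `β`: the partition function converges at `β`,
is positive, and its logarithm is differentiable there. -/
structure HasEntropyAt (Y : PhysicalSystem) (β : ℝ) : Prop where
  summable : Summable fun x : Y.State => Real.exp (-β * Y.energy x)
  pos : 0 < Y.partitionFunction β
  differentiable : DifferentiableAt ℝ (fun b => Real.log (Y.partitionFunction b)) β

end PhysicalSystem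

end

end ZetaEntropy

namespace ZetaEntropy

/-! ### Sums over tuples and over finitely supported functions -/

/-! Every entropy here has the form `(1 - s d/ds) log Z`, so it suffices to match partition
functions near `s`. A point of `X` over the degree-`m` extension of `k` is a closed point `x` with
`deg x ∣ m` together with one of the `deg x` embeddings of `κ(x)` (`nonempty_rationalPoints_equiv`).
Regrouping the Hasse–Weil series by closed points turns it into `∑ₓ -log (1 - t ^ deg x)`.
Exponentiating gives the Euler product, which expands to `∑_α t ^ deg α` (`hasSum_effectiveCycles`).
Thus `Z(X, q ^ (-s))` is the partition function of the effective zero-cycles with energies `deg α ·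
log q`, and `P` is its Gibbs distribution. Since `log P = -s E - log Z` and the mean energy is
`-Z'/Z`, the Shannon entropy is the thermodynamical one (`gibbs_entropy`). If `X` has `∑_{i ∈ I} q ^
(i m)` points over the degree-`m` extension, the logarithm series gives `log Z = -∑_{i ∈ I} log (1 -
q ^ (i - s))`. Here `I` is `{0}`, `{n}` or `{0, …, n}`. On the physical side, degeneracies `q ^ (j
i)` give a geometric series with sum `(1 - q ^ (i - β))⁻¹`, and composites multiply partition
functions. -/

theorem hasSum_pi_prod_fin {n : ℕ} {κ : Fin n → Type} {f : ∀ i, κ i → ℝ} {a : Fin n → ℝ}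
    (hf : ∀ i x, 0 ≤ f i x) (h : ∀ i, HasSum (f i) (a i)) :
    HasSum (fun x : ∀ i, κ i => ∏ i, f i (x i)) (∏ i, a i) := by
  induction n with
  | zero => simp
  | succ n ih =>
    have ih := ih (κ := fun i => κ (Fin.succ i)) (f := fun i => f (Fin.succ i))
      (a := fun i => a (Fin.succ i)) (fun i => hf (Fin.succ i)) (fun i => h (Fin.succ i))
    have hs : Summable fun x : κ 0 × (∀ i, κ (Fin.succ i)) =>
        f 0 x.1 * ∏ i, f (Fin.succ i) (x.2 i) :=
      Summable.mul_of_nonneg (f := f 0)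
        (g := fun x : ∀ i, κ (Fin.succ i) => ∏ i, f (Fin.succ i) (x i))
        (h 0).summable ih.summable (hf 0) (fun x => Finset.prod_nonneg fun i _ => hf _ _)
    have h1 := (h 0).mul ih hs
    rw [← (Fin.consEquiv κ).hasSum_iff, Fin.prod_univ_succ]
    refine h1.congr_fun fun x => ?_
    simp [Fin.prod_univ_succ, Fin.consEquiv]

theorem hasSum_pi_prod {ι : Type} [Fintype ι] {κ : Type} {f : ι → κ → ℝ} {a : ι → ℝ}
    (hf : ∀ i x, 0 ≤ f i x) (h : ∀ i, HasSum (f i) (a i)) :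
    HasSum (fun x : ι → κ => ∏ i, f i (x i)) (∏ i, a i) := by
  let e := Fintype.equivFin ι
  have := hasSum_pi_prod_fin (f := fun i => f (e.symm i)) (fun i => hf (e.symm i))
    (fun i => h (e.symm i))
  rw [← (e.symm.arrowCongr (Equiv.refl κ)).hasSum_iff, ← e.symm.prod_comp]
  refine this.congr_fun fun x => ?_
  simp only [Function.comp_apply]
  rw [← e.symm.prod_comp]
  simp

/-- Functions supported in a finite set `S` contribute exactly `∏ i ∈ S, a i`. As `f i 0 = 1` forces
`a i ≥ 1`, these products increase to `A`. All terms are nonnegative, so `A` is the least upper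
bound of the finite sums. -/
theorem hasSum_finsupp_prod {C : Type} {f : C → ℕ → ℝ} {a : C → ℝ} {A : ℝ}
    (hf : ∀ i x, 0 ≤ f i x) (hf0 : ∀ i, f i 0 = 1) (h : ∀ i, HasSum (f i) (a i))
    (hA : HasProd a A) :
    HasSum (fun α : C →₀ ℕ => α.prod f) A := by
  classical
  have hS (S : Finset C) : HasSum (fun α : {α : C →₀ ℕ // ↑α.support ⊆ (S : Set C)} => α.1.prod f)
      (∏ i ∈ S, a i) := by
    have h1 := hasSum_pi_prod (ι := S) (f := fun i => f i) (fun i => hf i) (fun i => h i)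
    rw [Finset.prod_coe_sort S a] at h1
    let e := (Finsupp.restrictSupportEquiv (S : Set C) ℕ).trans Finsupp.equivFunOnFinite
    refine (e.hasSum_iff.mpr h1).congr_fun fun α => ?_
    simp only [Function.comp_apply]
    rw [Finsupp.prod_of_support_subset α.1 (s := S) (by exact_mod_cast α.2) _ (fun i _ => hf0 i)]
    rw [← Finset.prod_coe_sort]
    rfl
  have hnn (α : C →₀ ℕ) : 0 ≤ α.prod f := Finset.prod_nonneg fun i _ => hf _ _
  have ha (i : C) : 1 ≤ a i := by
    rw [← hf0 i]; exact le_hasSum (h i) 0 (fun j _ => hf i j)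
  refine hasSum_of_isLUB_of_nonneg _ hnn ⟨?_, ?_⟩
  · rintro _ ⟨F, rfl⟩
    let S := F.biUnion Finsupp.support
    have h1 : ∏ i ∈ S, a i ≤ A := by
      refine ge_of_tendsto hA ?_
      filter_upwards [Filter.eventually_ge_atTop S] with T hT
      exact Finset.prod_le_prod_of_subset_of_one_le hT
        (fun i _ => zero_le_one.trans (ha i)) (fun i _ _ => ha i)
    refine le_trans ?_ h1
    have h2 := sum_le_hasSum (F.subtype (fun α : C →₀ ℕ => (α.support : Set C) ⊆ S))
      (fun α _ => hnn α.1) (hS S)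
    rwa [Finset.sum_subtype_of_mem (fun α : C →₀ ℕ => α.prod f)] at h2
    intro α hα
    exact_mod_cast Finset.subset_biUnion_of_mem Finsupp.support hα
  · intro B hB
    refine le_of_tendsto hA (Filter.Eventually.of_forall fun S => ?_)
    refine hasSum_le_of_sum_le (hS S) fun F => ?_
    refine le_trans (le_of_eq ?_) (hB ⟨F.map (Function.Embedding.subtype _), rfl⟩)
    simp

/-! ### The Euler product -/

/-- Abstract Euler product: `C` plays the closed points, `d` their degrees, and `N m` the points
over the extension of degree `m + 1`. -/
theorem hasSum_effectiveCycles {C : Type} {d : C → ℕ} (hd : ∀ c, 0 < d c) {N : ℕ → Type}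
    (e : ∀ m : ℕ, N m ≃ Σ c : {c : C // d c ∣ m + 1}, Fin (d c)) [∀ m, Finite (N m)]
    {t : ℝ} (ht : 0 < t) (ht1 : t < 1) {L : ℝ}
    (hL : HasSum (fun m : ℕ => (Nat.card (N m) : ℝ) * t ^ (m + 1) / ((m + 1 : ℕ) : ℝ)) L) :
    HasSum (fun α : C →₀ ℕ => t ^ (α.sum fun c a => a * d c)) (Real.exp L) := by
  have h1 : HasSum (fun x : Σ m, N m => t ^ (x.1 + 1) / ((x.1 + 1 : ℕ) : ℝ)) L := by
    have hf (m : ℕ) : HasSum (fun _ : N m => t ^ (m + 1) / ((m + 1 : ℕ) : ℝ))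
        ((Nat.card (N m) : ℝ) * t ^ (m + 1) / ((m + 1 : ℕ) : ℝ)) := by
      have := Fintype.ofFinite (N m)
      convert hasSum_fintype (fun _ : N m => t ^ (m + 1) / ((m + 1 : ℕ) : ℝ)) using 1
      simp [mul_div_assoc]
    refine HasSum.sigma_of_hasSum hL hf ?_
    rw [summable_sigma_of_nonneg (fun x => by positivity)]
    refine ⟨fun m => (hf m).summable, ?_⟩
    simpa only [(hf _).tsum_eq] using hL.summable
  -- Reindexing by `m + 1 = d c * (j + 1)`; both shifts come from indexing positive integers by `ℕ`.
  let E : (Σ m, N m) ≃ Σ c : C, ℕ × Fin (d c) :=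
    (Equiv.sigmaCongrRight e).trans
    { toFun x := ⟨x.2.1.1, (x.1 + 1) / d x.2.1.1 - 1, x.2.2⟩
      invFun y := ⟨d y.1 * (y.2.1 + 1) - 1, ⟨⟨y.1, by
        rw [Nat.sub_add_cancel (Nat.mul_pos (hd _) (Nat.succ_pos _))]
        exact dvd_mul_right _ _⟩, y.2.2⟩⟩
      left_inv := by
        rintro ⟨m, ⟨c, ⟨j, hj⟩⟩, i⟩
        have hj0 : 0 < j := by
          rcases Nat.eq_zero_or_pos j with rfl | h
          · simp at hj
          · exact h
        have hm : d c * ((m + 1) / d c - 1 + 1) - 1 = m := by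
          rw [hj, Nat.mul_div_cancel_left _ (hd c), Nat.sub_add_cancel hj0, ← hj]
          simp
        have key : ∀ (m' : ℕ) (h : m' = m) (p : d c ∣ m' + 1) (p' : d c ∣ m + 1),
            (⟨m', ⟨⟨c, p⟩, i⟩⟩ : Σ m, Σ c : {c : C // d c ∣ m + 1}, Fin (d c)) =
              ⟨m, ⟨⟨c, p'⟩, i⟩⟩ := by
          rintro _ rfl _ _; rfl
        exact key _ hm _ _
      right_inv := by
        rintro ⟨c, j, i⟩
        have : (d c * (j + 1) - 1 + 1) / d c - 1 = j := by
          rw [Nat.sub_add_cancel (Nat.mul_pos (hd _) (Nat.succ_pos _)),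
            Nat.mul_div_cancel_left _ (hd c)]
          simp
        simp [this] }
  have hE (x : Σ m, N m) : d (E x).1 * ((E x).2.1 + 1) = x.1 + 1 := by
    have := (e x.1 x.2).1.2
    have h0 : 0 < (x.1 + 1) / d (e x.1 x.2).1.1 :=
      Nat.div_pos (Nat.le_of_dvd (Nat.succ_pos _) this) (hd _)
    change d (e x.1 x.2).1.1 * ((x.1 + 1) / d (e x.1 x.2).1.1 - 1 + 1) = _
    rw [Nat.sub_add_cancel h0, Nat.mul_div_cancel' this]
  have h2 : HasSum (fun y : Σ c : C, ℕ × Fin (d c) =>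
      t ^ (d y.1 * (y.2.1 + 1)) / ((d y.1 * (y.2.1 + 1) : ℕ) : ℝ)) L := by
    rw [← E.hasSum_iff]
    refine h1.congr_fun fun x => ?_
    simp only [Function.comp_apply, hE]
  have htd (c : C) : t ^ d c < 1 := pow_lt_one₀ ht.le ht1 (hd c).ne'
  have h3 : HasSum (fun c : C => -Real.log (1 - t ^ d c)) L := by
    refine h2.sigma fun c => ?_
    have h4 := Real.hasSum_pow_div_log_of_abs_lt_one (x := t ^ d c)
      (by rw [abs_of_pos (by positivity)]; exact htd c)
    rw [← (Equiv.sigmaEquivProd _ _).hasSum_iff]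
    refine HasSum.sigma_of_hasSum (h4) (γ := fun _ => Fin (d c)) (fun j => ?_) ?_
    -- The `d c` embeddings cancel the factor `d c` in the denominator, leaving the series of `-log
    -- (1 - t ^ d c)`.
    · have hfib : HasSum (fun _ : Fin (d c) => t ^ (d c * (j + 1)) / ((d c * (j + 1) : ℕ) : ℝ))
          ((t ^ d c) ^ (j + 1) / ((j : ℝ) + 1)) := by
        convert hasSum_fintype (fun _ : Fin (d c) =>
          t ^ (d c * (j + 1)) / ((d c * (j + 1) : ℕ) : ℝ)) using 1
        have : (d c : ℝ) ≠ 0 := by exact_mod_cast (hd c).ne'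
        simp only [Finset.sum_const, Finset.card_univ, Fintype.card_fin, nsmul_eq_mul]
        push_cast
        field_simp
        rw [← pow_mul]
      exact hfib
    · exact (Equiv.sigmaEquivProd _ _).summable_iff.mpr (h2.summable.sigma_factor c)
  have h5 := h3.rexp
  have h6 : HasProd (fun c : C => (1 - t ^ d c)⁻¹) (Real.exp L) := by
    refine h5.congr_fun fun c => ?_
    simp only [Function.comp_apply]
    rw [Real.exp_neg, Real.exp_log (by linarith [htd c])]
  have := hasSum_finsupp_prod (f := fun c a => (t ^ d c) ^ a) (fun c a => by positivity)
    (fun c => pow_zero _)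
    (fun c => hasSum_geometric_of_lt_one (by positivity) (htd c)) h6
  refine this.congr_fun fun α => ?_
  rw [Finsupp.sum, ← Finset.prod_pow_eq_pow_sum, Finsupp.prod]
  refine Finset.prod_congr rfl fun c _ => ?_
  rw [← pow_mul, mul_comm]

/-! ### Entropy of Gibbs distributions -/

theorem hasDerivAt_partitionSum {A : Type} {E : A → ℝ} (hE : ∀ a, 0 ≤ E a) {n s : ℝ} (hn : n < s)
    (h : ∀ u, n < u → Summable fun a => Real.exp (-u * E a)) :
    Summable (fun a => E a * Real.exp (-s * E a)) ∧
    HasDerivAt (fun u => ∑' a, Real.exp (-u * E a)) (-∑' a, E a * Real.exp (-s * E a)) s := by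
  -- With `n < r' < r < s`, the gap `r - r'` absorbs the factor `E a` through `x ≤ exp x`. This
  -- bounds the differentiated terms on all of `(r, ∞)` by a multiple of the convergent series at
  -- `r'`.
  obtain ⟨r, hnr, hrs⟩ := exists_between hn
  obtain ⟨r', hnr', hr'⟩ := exists_between hnr
  have hb (y : ℝ) (hy : r < y) (a : A) :
      E a * Real.exp (-y * E a) ≤ (r - r')⁻¹ * Real.exp (-r' * E a) := by
    have h0 : 0 < r - r' := sub_pos.mpr hr'
    rw [inv_mul_eq_div, le_div_iff₀ h0]
    have h1 : (r - r') * E a ≤ Real.exp ((r - r') * E a) := by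
      linarith [Real.add_one_le_exp ((r - r') * E a)]
    calc E a * Real.exp (-y * E a) * (r - r')
        = (r - r') * E a * Real.exp (-y * E a) := by ring
      _ ≤ Real.exp ((r - r') * E a) * Real.exp (-r * E a) := by
          refine mul_le_mul h1 (Real.exp_le_exp.mpr ?_) (Real.exp_pos _).le (Real.exp_pos _).le
          nlinarith [hE a]
      _ = Real.exp (-r' * E a) := by rw [← Real.exp_add]; ring_nf
  have hsum := (h r' hnr').mul_left (r - r')⁻¹
  refine ⟨hsum.of_nonneg_of_le (fun a => mul_nonneg (hE a) (Real.exp_pos _).le)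
    (fun a => hb s hrs a), ?_⟩
  rw [← tsum_neg]
  refine hasDerivAt_tsum_of_isPreconnected (t := Set.Ioi r) (y₀ := s) hsum isOpen_Ioi
    isPreconnected_Ioi (g' := fun a y => -(E a * Real.exp (-y * E a))) ?_ ?_ hrs (h s hn) hrs
  · intro a y _
    exact ((((hasDerivAt_id y).neg.mul_const (E a))).exp).congr_deriv (by simp; ring)
  · intro a y hy
    rw [norm_neg, Real.norm_of_nonneg (mul_nonneg (hE a) (Real.exp_pos _).le)]
    exact hb y hy a

theorem gibbs_entropy {A : Type} {E : A → ℝ} (hE : ∀ a, 0 ≤ E a) {n s : ℝ} (hn : n < s)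
    {Z : ℝ → ℝ} (hpos : 0 < Z s) (h : ∀ u, n < u → HasSum (fun a => Real.exp (-u * E a)) (Z u)) :
    HasSum (fun a => Real.exp (-s * E a) / Z s) 1 ∧
    DifferentiableAt ℝ (fun u => Real.log (Z u)) s ∧
    HasSum (fun a => Real.exp (-s * E a) / Z s * Real.log (Real.exp (-s * E a) / Z s))
      (-oneSubEuler (fun u => Real.log (Z u)) s) := by
  obtain ⟨h1, h2⟩ := hasDerivAt_partitionSum hE hn (fun u hu => (h u hu).summable)
  have h3 : HasDerivAt Z (-∑' a, E a * Real.exp (-s * E a)) s := by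
    refine h2.congr_of_eventuallyEq ?_
    filter_upwards [Ioi_mem_nhds hn] with u hu
    exact (h u hu).tsum_eq.symm
  have h4 := h3.log hpos.ne'
  have hp : HasSum (fun a => Real.exp (-s * E a) / Z s) 1 := by
    simpa [hpos.ne'] using (h s hn).div_const (Z s)
  refine ⟨hp, h4.differentiableAt, ?_⟩
  rw [oneSubEuler, h4.deriv]
  have h5 := ((h1.hasSum.mul_left (-s)).div_const (Z s)).sub (hp.mul_right (Real.log (Z s)))
  have h6 : -(Real.log (Z s) - s * ((-∑' a, E a * Real.exp (-s * E a)) / Z s)) =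
      (-s * ∑' a, E a * Real.exp (-s * E a)) / Z s - 1 * Real.log (Z s) := by ring
  rw [h6]
  refine h5.congr_fun fun a => ?_
  rw [Real.log_div (Real.exp_pos _).ne' hpos.ne', Real.log_exp]
  ring

/-! ### Thermodynamics of systems with logarithmic energy levels -/

theorem one_sub_rpow_pos {q : ℝ} (hq : 1 < q) {x u : ℝ} (h : x < u) : 0 < 1 - q ^ (x - u) :=
  sub_pos.mpr (Real.rpow_lt_one_of_one_lt_of_neg hq (sub_neg.mpr h))

theorem differentiableAt_log_one_sub_rpow {q : ℝ} (hq : 1 < q) {x s : ℝ} (h : x < s) :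
    DifferentiableAt ℝ (fun u : ℝ => Real.log (1 - q ^ (x - u))) s := by
  have h0 := (one_sub_rpow_pos hq h).ne'
  refine DifferentiableAt.log ?_ h0
  refine (differentiableAt_const _).sub ?_
  exact (((hasDerivAt_const s q).rpow ((hasDerivAt_id s).const_sub x)
    (by positivity))).differentiableAt

theorem oneSubEuler_congr {g h : ℝ → ℝ} {s : ℝ} (e : g =ᶠ[nhds s] h) :
    oneSubEuler g s = oneSubEuler h s := by
  rw [oneSubEuler, oneSubEuler, e.deriv_eq, e.eq_of_nhds]

theorem oneSubEuler_neg (g : ℝ → ℝ) (s : ℝ) :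
    oneSubEuler (fun u => -g u) s = -oneSubEuler g s := by
  simp only [oneSubEuler, deriv.fun_neg]; ring

namespace PhysicalSystem

theorem hasSum_ofLevels {q : ℕ} (hq : 1 < q) (n : ℕ) {u : ℝ} (hu : (n : ℝ) < u) :
    HasSum (fun x : (ofLevels (fun j => j * Real.log q) (fun j => q ^ (j * n))).State =>
      Real.exp (-u * (ofLevels (fun j => j * Real.log q) (fun j => q ^ (j * n))).energy x))
      (1 - (q : ℝ) ^ ((n : ℝ) - u))⁻¹ := by
  have hq' : (1 : ℝ) < q := by exact_mod_cast hq
  have hq0 : (0 : ℝ) < q := by linarith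
  have h1 : HasSum (fun j : ℕ => ((q : ℝ) ^ ((n : ℝ) - u)) ^ j) (1 - (q : ℝ) ^ ((n : ℝ) - u))⁻¹ :=
    hasSum_geometric_of_lt_one (by positivity) (by linarith [one_sub_rpow_pos hq' hu])
  have h2 (j : ℕ) : HasSum (fun _ : Fin (q ^ (j * n)) => Real.exp (-u * (j * Real.log q)))
      (((q : ℝ) ^ ((n : ℝ) - u)) ^ j) := by
    convert hasSum_fintype (fun _ : Fin (q ^ (j * n)) => Real.exp (-u * (j * Real.log q))) using 1
    simp only [Finset.sum_const, Finset.card_univ, Fintype.card_fin, nsmul_eq_mul]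
    push_cast
    rw [← Real.rpow_natCast, ← Real.rpow_mul hq0.le, ← Real.rpow_natCast,
      Real.rpow_def_of_pos hq0, Real.rpow_def_of_pos hq0, ← Real.exp_add]
    push_cast
    ring_nf
  refine HasSum.sigma_of_hasSum h1 h2 ?_
  refine (summable_sigma_of_nonneg fun x => (Real.exp_pos _).le).mpr ⟨fun j => (h2 j).summable, ?_⟩
  simpa only [ofLevels, (h2 _).tsum_eq] using h1.summable

theorem hasSum_composite {k : ℕ} {Y : Fin k → PhysicalSystem} {u : ℝ} {a : Fin k → ℝ}
    (h : ∀ i, HasSum (fun x : (Y i).State => Real.exp (-u * (Y i).energy x)) (a i)) :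
    HasSum (fun x : (composite Y).State => Real.exp (-u * (composite Y).energy x))
      (∏ i, a i) := by
  refine (hasSum_pi_prod_fin (fun i x => (Real.exp_pos _).le) h).congr_fun fun x => ?_
  rw [← Real.exp_sum, ← Finset.mul_sum]
  rfl

/-- The partition function is controlled only for `u > n`; this suffices because `oneSubEuler`
depends only on the germ at `s`. -/
theorem hasEntropyAt_of_hasSum {Y : PhysicalSystem} {g : ℝ → ℝ} {n s : ℝ} (hs : n < s)
    (hg : DifferentiableAt ℝ g s)
    (h : ∀ u, n < u → HasSum (fun x : Y.State => Real.exp (-u * Y.energy x)) (Real.exp (-g u))) :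
    Y.HasEntropyAt s ∧ Y.entropy s = -oneSubEuler g s := by
  have hZ : (fun b => Real.log (Y.partitionFunction b)) =ᶠ[nhds s] fun u => -g u := by
    filter_upwards [Ioi_mem_nhds hs] with u hu
    rw [partitionFunction, (h u hu).tsum_eq, Real.log_exp]
  refine ⟨⟨(h s hs).summable, ?_, hg.fun_neg.congr_of_eventuallyEq hZ⟩, ?_⟩
  · rw [partitionFunction, (h s hs).tsum_eq]; exact Real.exp_pos _
  · rw [entropy, oneSubEuler_congr hZ, oneSubEuler_neg]

end PhysicalSystem

/-! ### Points with values in a finite field and closed points -/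

section Points

variable {k : Type} [Field k] {X : Scheme.{0}} (f : X ⟶ Spec (.of k))

/-- The embedding of the base field in the residue field of a point of a `k`-scheme. -/
noncomputable def baseToResidueField (x : X) : CommRingCat.of k ⟶ X.residueField x :=
  Spec.preimage (X.fromSpecResidueField x ≫ f)

theorem specMap_baseToResidueField (x : X) :
    Spec.map (baseToResidueField f x) = X.fromSpecResidueField x ≫ f :=
  Spec.map_preimage _

/-- `residueDegree` is taken over the residue field of the image point in `Spec k`. That point is
the zero ideal, so its residue field is `k`, and degrees can be computed over `k`. -/
theorem residueFieldMap_comp_base (x : X) :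
    ∃ e : CommRingCat.of k ≅ (Spec (.of k)).residueField (f x),
      e.hom ≫ f.residueFieldMap x = baseToResidueField f x := by
  let y : PrimeSpectrum k := f x
  have hb : Function.Bijective
      (algebraMap k y.asIdeal.ResidueField) := by
    refine ⟨RingHom.injective _, ?_⟩
    have : y.asIdeal.IsMaximal := by
      have h := y.isPrime
      rcases Ideal.eq_bot_or_top (K := k) y.asIdeal with h0 | h0
      · rw [h0]; exact Ideal.bot_isMaximal (K := k)
      · exact absurd h0 h.ne_top
    exact y.asIdeal.algebraMap_residueField_surjective
  let e0 : CommRingCat.of k ≅ CommRingCat.of y.asIdeal.ResidueField :=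
    (RingEquiv.ofBijective _ hb).toCommRingCatIso
  refine ⟨e0 ≪≫ (Scheme.Spec.residueFieldIso (.of k) y).symm, ?_⟩
  apply Spec.map_injective
  rw [Spec.map_comp, specMap_baseToResidueField,
    ← Scheme.Hom.SpecMap_residueFieldMap_fromSpecResidueField]
  congr 1
  rw [← Scheme.Spec.map_residueFieldIso_inv_eq_fromSpecResidueField, ← Spec.map_comp]
  rfl

theorem residueDegree_eq_finrank (x : X) :
    letI := (baseToResidueField f x).hom.toAlgebra
    f.residueDegree x = Module.finrank k (X.residueField x) := by
  let := (baseToResidueField f x).hom.toAlgebra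
  let := (f.residueFieldMap x).hom.toAlgebra
  obtain ⟨e, he⟩ := residueFieldMap_comp_base f x
  symm
  refine Algebra.finrank_eq_of_equiv_equiv e.commRingCatIsoToRingEquiv (RingEquiv.refl _) ?_
  have := congrArg CommRingCat.Hom.hom he
  ext a
  exact congrArg (fun g => g a) this

/-- This is the Nullstellensatz: `X` is Jacobson, so `x` is closed iff `Spec κ(x) ⟶ X` is locally of
finite type. That is equivalent to the same property over `k`, which for a field extension means
finiteness. -/
theorem isClosed_iff_finite [LocallyOfFiniteType f] (x : X) :
    IsClosed {x} ↔ (baseToResidueField f x).hom.Finite := by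
  have : JacobsonSpace X := LocallyOfFiniteType.jacobsonSpace f
  rw [isClosed_singleton_iff_locallyOfFiniteType]
  rw [← IsFinite.SpecMap_iff, specMap_baseToResidueField,
    isFinite_iff_locallyOfFiniteType_of_jacobsonSpace]
  exact ⟨fun _ => inferInstance, fun _ => locallyOfFiniteType_of_comp _ f⟩

theorem specToEquivOfField_symm_comp_eq_iff (K : Type) [Field K] [Algebra k K] (x : X)
    (φ : X.residueField x ⟶ .of K) :
    (Scheme.SpecToEquivOfField K X).symm ⟨x, φ⟩ ≫ f =
        Spec.map (CommRingCat.ofHom (algebraMap k K)) ↔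
      baseToResidueField f x ≫ φ = CommRingCat.ofHom (algebraMap k K) := by
  have h : (Scheme.SpecToEquivOfField K X).symm ⟨x, φ⟩ ≫ f =
      Spec.map (baseToResidueField f x ≫ φ) := by
    rw [Spec.map_comp, specMap_baseToResidueField, ← Category.assoc]
    rfl
  rw [h, Spec.map_injective.eq_iff]

/-- A `K`-point is a point of the scheme together with a `k`-embedding of its residue field. -/
noncomputable def rationalPointsEquivSigma (K : Type) [Field K] [Algebra k K] :
    RationalPoints f K ≃
      Σ x : X, {φ : X.residueField x ⟶ .of K //
        baseToResidueField f x ≫ φ = CommRingCat.ofHom (algebraMap k K)} where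
  toFun g := ⟨(Scheme.SpecToEquivOfField K X g.1).1, (Scheme.SpecToEquivOfField K X g.1).2, by
    rw [← specToEquivOfField_symm_comp_eq_iff, Sigma.eta, Equiv.symm_apply_apply]
    exact g.2⟩
  invFun y := ⟨(Scheme.SpecToEquivOfField K X).symm ⟨y.1, y.2.1⟩,
    (specToEquivOfField_symm_comp_eq_iff f K y.1 y.2.1).mpr y.2.2⟩
  left_inv g := Subtype.ext ((Scheme.SpecToEquivOfField K X).symm_apply_apply g.1)
  right_inv y := by
    obtain ⟨x, φ, h⟩ := y
    have key : ∀ (z w : Σ x : X, X.residueField x ⟶ .of K) (e : z = w)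
        (hz : baseToResidueField f z.1 ≫ z.2 = CommRingCat.ofHom (algebraMap k K))
        (hw : baseToResidueField f w.1 ≫ w.2 = CommRingCat.ofHom (algebraMap k K)),
        (⟨z.1, z.2, hz⟩ : Σ x : X, {φ : X.residueField x ⟶ .of K //
          baseToResidueField f x ≫ φ = CommRingCat.ofHom (algebraMap k K)}) = ⟨w.1, w.2, hw⟩ := by
      rintro z _ rfl _ _; rfl
    exact key _ ⟨x, φ⟩ ((Scheme.SpecToEquivOfField K X).apply_symm_apply ⟨x, φ⟩) _ h

variable [LocallyOfFiniteType f]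

theorem residueDegree_pos (x : closedPoints X) : 0 < f.residueDegree x.1 := by
  let := (baseToResidueField f x.1).hom.toAlgebra
  have : Module.Finite k (X.residueField x.1) := (isClosed_iff_finite f x.1).mp x.2
  rw [residueDegree_eq_finrank]
  exact Module.finrank_pos

theorem nonempty_equiv_embeddings [Finite k] (K : Type) [Field K] [Algebra k K] [Finite K] (x : closedPoints X)
    (h : f.residueDegree x.1 ∣ Module.finrank k K) :
    Nonempty ({φ : X.residueField x.1 ⟶ .of K //
        baseToResidueField f x.1 ≫ φ = CommRingCat.ofHom (algebraMap k K)} ≃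
      Fin (f.residueDegree x.1)) := by
  let := (baseToResidueField f x.1).hom.toAlgebra
  have : Module.Finite k (X.residueField x.1) := (isClosed_iff_finite f x.1).mp x.2
  have hd := residueDegree_eq_finrank f x.1
  have hc : Nat.card (X.residueField x.1 →ₐ[k] K) = f.residueDegree x.1 := by
    rw [hd]
    rw [hd] at h
    exact FiniteField.natCard_algHom_of_finrank_dvd h
  have hfin : Finite (X.residueField x.1 →ₐ[k] K) :=
    Nat.finite_of_card_ne_zero (hc ▸ (residueDegree_pos f x).ne')
  let e : {φ : X.residueField x.1 ⟶ .of K //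
      baseToResidueField f x.1 ≫ φ = CommRingCat.ofHom (algebraMap k K)} ≃
      (X.residueField x.1 →ₐ[k] K) :=
    { toFun φ := { φ.1.hom with
        commutes' := fun a => congrArg (fun g => g.hom a) φ.2 }
      invFun ψ := ⟨CommRingCat.ofHom ψ.toRingHom, by
        ext a
        exact ψ.commutes a⟩
      left_inv _ := rfl
      right_inv _ := rfl }
  exact ⟨e.trans (Finite.equivFinOfCardEq hc)⟩

/-- The residue field embeds in the finite field `K`, so it is finite over `k`, and its degree
divides that of `K`. Hence only closed points carry `K`-points. -/
theorem isClosed_and_dvd (K : Type) [Field K] [Algebra k K] [Finite K] (x : X)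
    (φ : X.residueField x ⟶ .of K)
    (h : baseToResidueField f x ≫ φ = CommRingCat.ofHom (algebraMap k K)) :
    IsClosed {x} ∧ f.residueDegree x ∣ Module.finrank k K := by
  let := (baseToResidueField f x).hom.toAlgebra
  let ψ : X.residueField x →ₐ[k] K :=
    { φ.hom with commutes' := fun a => congrArg (fun g => g.hom a) h }
  have : Finite (X.residueField x) := Finite.of_injective ψ ψ.toRingHom.injective
  refine ⟨(isClosed_iff_finite f x).mpr ?_, ?_⟩
  · exact (Module.Finite.of_finite : Module.Finite k (X.residueField x))
  · rw [residueDegree_eq_finrank]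
    exact FiniteField.nonempty_algHom_iff_finrank_dvd.mp ⟨ψ⟩

theorem nonempty_rationalPoints_equiv [Finite k] (K : Type) [Field K] [Algebra k K] [Finite K] {m : ℕ}
    (hm : Module.finrank k K = m) :
    Nonempty (RationalPoints f K ≃
      Σ x : {x : closedPoints X // f.residueDegree x.1 ∣ m}, Fin (f.residueDegree x.1.1)) := by
  subst hm
  let T := {x : closedPoints X // f.residueDegree x.1 ∣ Module.finrank k K}
  have e (x : T) := (nonempty_equiv_embeddings f K x.1 x.2).some
  refine ⟨(rationalPointsEquivSigma f K).trans (Equiv.trans ?_ (Equiv.sigmaCongrRight e))⟩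
  exact
    { toFun y := ⟨⟨⟨y.1, (isClosed_and_dvd f K y.1 y.2.1 y.2.2).1⟩,
        (isClosed_and_dvd f K y.1 y.2.1 y.2.2).2⟩, y.2⟩
      invFun y := ⟨y.1.1.1, y.2⟩
      left_inv _ := rfl
      right_inv _ := rfl }

end Points

/-! ### Shannon entropy from point counts -/

section Entropy

variable (p : ℕ) [Fact p.Prime] {k : Type} [Field k] [Finite k] [CharP k p] {X : Scheme.{0}}
  (f : X ⟶ Spec (.of k))

/-- The logarithm of the inverse of the zeta function when `card X(𝔽_{q^m}) = ∑_{i ∈ I} q^{im}`. -/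
noncomputable def logInvZeta (q : ℕ) (I : Finset ℕ) (u : ℝ) : ℝ :=
  ∑ i ∈ I, Real.log (1 - (q : ℝ) ^ ((i : ℝ) - u))

theorem differentiableAt_logInvZeta {q : ℕ} (hq : 1 < q) {I : Finset ℕ} {s : ℝ}
    (hs : ∀ i ∈ I, (i : ℝ) < s) : DifferentiableAt ℝ (logInvZeta q I) s :=
  DifferentiableAt.fun_sum fun i hi =>
    differentiableAt_log_one_sub_rpow (by exact_mod_cast hq) (hs i hi)

theorem hasSum_zetaTerm {I : Finset ℕ}
    (hN : ∀ m, Nat.card (RationalPoints f (FiniteField.Extension k p (m + 1))) =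
      ∑ i ∈ I, Nat.card k ^ (i * (m + 1))) {u : ℝ} (hu : ∀ i ∈ I, (i : ℝ) < u) :
    HasSum (fun m : ℕ => zetaTerm p f ((Nat.card k : ℝ) ^ (-u)) (m + 1))
      (-logInvZeta (Nat.card k) I u) := by
  have hq : (1 : ℝ) < Nat.card k := by exact_mod_cast Finite.one_lt_card
  have hq0 : (0 : ℝ) < Nat.card k := by linarith
  rw [logInvZeta, ← Finset.sum_neg_distrib]
  have h (i : ℕ) (hi : i ∈ I) := Real.hasSum_pow_div_log_of_abs_lt_one
    (x := (Nat.card k : ℝ) ^ ((i : ℝ) - u)) (by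
      rw [abs_of_pos (by positivity)]
      linarith [one_sub_rpow_pos hq (hu i hi)])
  refine (hasSum_sum h).congr_fun fun m => ?_
  rw [zetaTerm, hN, Nat.cast_sum, Finset.sum_mul, Finset.sum_div]
  refine Finset.sum_congr rfl fun i _ => ?_
  push_cast
  congr 1
  rw [pow_mul, ← mul_pow, ← Real.rpow_natCast _ i, ← Real.rpow_add hq0, sub_eq_add_neg]

/-- The bound `0 ≤ r` ensures `q ^ (-u) < 1` for every `u > r`, as the Euler product requires. -/
theorem shannonEntropy_of_card [LocallyOfFiniteType f] {I : Finset ℕ} (hI : I.Nonempty)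
    (hN : ∀ m, Nat.card (RationalPoints f (FiniteField.Extension k p (m + 1))) =
      ∑ i ∈ I, Nat.card k ^ (i * (m + 1))) {r s : ℝ} (hr0 : 0 ≤ r) (hr : ∀ i ∈ I, (i : ℝ) ≤ r)
    (hs : r < s) :
    HasShannonEntropyAt p f s ∧
      shannonEntropy p f s = -oneSubEuler (logInvZeta (Nat.card k) I) s := by
  have hq : (1 : ℝ) < Nat.card k := by exact_mod_cast Finite.one_lt_card
  have hq0 : (0 : ℝ) < Nat.card k := by linarith
  have hsum (u : ℝ) (hu : r < u) := hasSum_zetaTerm p f hN (u := u) fun i hi =>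
    (hr i hi).trans_lt hu
  have hZ (u : ℝ) (hu : r < u) : hasseWeilZeta p f ((Nat.card k : ℝ) ^ (-u)) =
      Real.exp (-logInvZeta (Nat.card k) I u) := by
    rw [hasseWeilZeta, (hsum u hu).tsum_eq]
  have hfin (m : ℕ) : Finite (RationalPoints f (FiniteField.Extension k p (m + 1))) := by
    -- `Nat.card` of an infinite type is `0`, so a positive count proves finiteness; positivity uses
    -- `I` nonempty.
    refine Nat.finite_of_card_ne_zero ?_
    rw [hN]
    exact (Finset.sum_pos (fun i _ => pow_pos Nat.card_pos _) hI).ne'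
  have e (m : ℕ) := (nonempty_rationalPoints_equiv f (FiniteField.Extension k p (m + 1))
    (FiniteField.finrank_extension k p (m + 1))).some
  have ht (u : ℝ) (α : EffectiveZeroCycle X) :
      ((Nat.card k : ℝ) ^ (-u)) ^ zeroCycleDegree f α =
        Real.exp (-u * (zeroCycleDegree f α * Real.log (Nat.card k))) := by
    rw [← Real.rpow_natCast, ← Real.rpow_mul hq0.le, Real.rpow_def_of_pos hq0]
    ring_nf
  have hcyc (u : ℝ) (hu : r < u) :
      HasSum (fun α : EffectiveZeroCycle X =>
        Real.exp (-u * (zeroCycleDegree f α * Real.log (Nat.card k))))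
        (Real.exp (-logInvZeta (Nat.card k) I u)) := by
    simp only [← ht]
    exact hasSum_effectiveCycles (residueDegree_pos f) e (Real.rpow_pos_of_pos hq0 _)
      (Real.rpow_lt_one_of_one_lt_of_neg hq (by linarith)) (hsum u hu)
  obtain ⟨h1, -, h3⟩ := gibbs_entropy (Z := fun u => Real.exp (-logInvZeta (Nat.card k) I u))
    (fun α => mul_nonneg (Nat.cast_nonneg _)
    (Real.log_nonneg hq.le)) hs (Real.exp_pos _) hcyc
  have hP (α : EffectiveZeroCycle X) : cycleProb p f ((Nat.card k : ℝ) ^ (-s)) α =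
      Real.exp (-s * (zeroCycleDegree f α * Real.log (Nat.card k))) /
        Real.exp (-logInvZeta (Nat.card k) I s) := by
    rw [cycleProb, hZ s hs, ht]
  simp only [Real.log_exp, oneSubEuler_neg, ← hP] at h1 h3
  refine ⟨⟨(hsum s hs).summable, fun α => ?_, h1, h3.summable⟩, ?_⟩
  · rw [hP]; positivity
  · rw [shannonEntropy, h3.tsum_eq, neg_neg]

end Entropy

/-! ### Counting points -/

section Count

variable (k : Type) [Field k] (K : Type) [Field K] [Algebra k K]

theorem natCard_rationalPoints_id :
    Nat.card (RationalPoints (𝟙 (Spec (.of k))) K) = 1 := by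
  rw [Nat.card_eq_one_iff_unique]
  refine ⟨⟨fun g h => Subtype.ext ?_⟩, ⟨⟨_, Category.comp_id _⟩⟩⟩
  rw [← Category.comp_id g.1, g.2, ← Category.comp_id h.1, h.2]

theorem natCard_rationalPoints_affineSpaceHom (n : ℕ) :
    Nat.card (RationalPoints (affineSpaceHom k n) K) = Nat.card K ^ n := by
  let : (Spec (.of K)).Over (Spec (.of k)) := ⟨Spec.map (CommRingCat.ofHom (algebraMap k K))⟩
  let e1 : RationalPoints (affineSpaceHom k n) K ≃
      {g : Spec (.of K) ⟶ 𝔸(Fin n; Spec (.of k)) // g.IsOver (Spec (.of k))} :=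
    Equiv.subtypeEquivRight fun g => ⟨fun h => ⟨h⟩, fun h => h.1⟩
  let e2 : (Fin n → Γ(Spec (.of K), ⊤)) ≃ (Fin n → K) :=
    Equiv.arrowCongr (Equiv.refl _) (Scheme.ΓSpecIso (.of K)).commRingCatIsoToRingEquiv.toEquiv
  rw [Nat.card_congr ((e1.trans (AffineSpace.homOverEquiv _)).trans e2), Nat.card_fun, Nat.card_fin]

attribute [local instance] MvPolynomial.gradedAlgebra

instance (n : ℕ) : LocallyOfFiniteType (affineSpaceHom k n) := by
  unfold affineSpaceHom; infer_instance

theorem algebraMap_homogeneousSubmodule_zero_surjective (σ : Type) :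
    Function.Surjective (algebraMap k (MvPolynomial.homogeneousSubmodule σ k 0)) := by
  rintro ⟨a, ha⟩
  have ha' := ha
  rw [MvPolynomial.homogeneousSubmodule_zero, Submodule.mem_one] at ha'
  obtain ⟨c, rfl⟩ := ha'
  exact ⟨c, rfl⟩

/-- The polynomial ring is of finite type over its degree-zero part, and that part is a quotient of
`k`. -/
instance (n : ℕ) : LocallyOfFiniteType (projectiveSpaceHom k n) := by
  have : IsScalarTower k (MvPolynomial.homogeneousSubmodule (Fin (n + 1)) k 0)
      (MvPolynomial (Fin (n + 1)) k) := 
    ⟨fun a b c => smul_mul_assoc a (b : MvPolynomial (Fin (n + 1)) k) c⟩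
  have : Algebra.FiniteType (MvPolynomial.homogeneousSubmodule (Fin (n + 1)) k 0)
      (MvPolynomial (Fin (n + 1)) k) :=
    .of_restrictScalars_finiteType k _ _
  have : LocallyOfFiniteType (Spec.map (CommRingCat.ofHom
      (algebraMap k (MvPolynomial.homogeneousSubmodule (Fin (n + 1)) k 0)))) := by
    rw [HasRingHomProperty.Spec_iff (P := @LocallyOfFiniteType)]
    exact RingHom.FiniteType.of_surjective _
      (algebraMap_homogeneousSubmodule_zero_surjective k _)
  exact MorphismProperty.comp_mem @LocallyOfFiniteType
    (Proj.toSpecZero (MvPolynomial.homogeneousSubmodule (Fin (n + 1)) k)) _ inferInstance this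

end Count

/-! ### Rational points of projective space via homogeneous coordinates -/

section ProjectiveSpace

attribute [local instance] MvPolynomial.gradedAlgebra

open MvPolynomial HomogeneousLocalization

variable (k : Type) [Field k] {n : ℕ}

/-- The grading of `k[x₀, …, xₙ]` by total degree. -/
local notation "𝒜" => homogeneousSubmodule (Fin (n + 1)) k

theorem X_mem_one (i : Fin (n + 1)) : (X i : MvPolynomial (Fin (n + 1)) k) ∈ 𝒜 1 :=
  isHomogeneous_X k i

/-- The coordinate `xⱼ / xᵢ` on the chart `D₊(xᵢ)` of projective space. -/
noncomputable def chartCoord (i j : Fin (n + 1)) :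
    Away 𝒜 (X i : MvPolynomial (Fin (n + 1)) k) :=
  Away.isLocalizationElem (X_mem_one k i) (X_mem_one k j)

/-- The constants in the coordinate ring of the chart `D₊(xᵢ)`. -/
noncomputable def chartConst (i : Fin (n + 1)) :
    k →+* Away 𝒜 (X i : MvPolynomial (Fin (n + 1)) k) :=
  (fromZeroRingHom 𝒜 _).comp (algebraMap k (𝒜 0))

/-- Dehomogenisation: in the full localization, multiplying by `X i ^ m` clears denominators, since
each monomial of `a` has degree exactly `m`. It shows that constants and the `xⱼ / xᵢ` generate the
chart. -/
theorem away_mk_eq_eval₂ (i : Fin (n + 1)) (m : ℕ) (a : MvPolynomial (Fin (n + 1)) k)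
    (ha : a ∈ 𝒜 (m • 1)) :
    Away.mk 𝒜 (X_mem_one k i) m a ha = eval₂ (chartConst k i) (chartCoord k i) a := by
  have hv : Function.Injective (algebraMap (Away 𝒜 (X i : MvPolynomial (Fin (n + 1)) k))
    (Localization.Away (X i : MvPolynomial (Fin (n + 1)) k))) := val_injective _
  apply hv
  let ι := algebraMap (MvPolynomial (Fin (n + 1)) k)
    (Localization.Away (X i : MvPolynomial (Fin (n + 1)) k))
  have hu : IsUnit (ι (X i)) := IsLocalization.Away.algebraMap_isUnit _
  have hcoord (j : Fin (n + 1)) : ι (X i) * algebraMap _ _ (chartCoord k i j) = ι (X j) := by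
    change ι (X i) * Localization.mk _ _ = _
    simp only [ι]
    rw [← Localization.mk_one_eq_algebraMap, Localization.mk_mul,
      ← Localization.mk_one_eq_algebraMap, Localization.mk_eq_mk_iff, Localization.r_iff_exists]
    exact ⟨1, by simp⟩
  have hconst (c : k) : algebraMap _ (Localization.Away (X i : MvPolynomial (Fin (n + 1)) k))
      (chartConst k i c) = ι (C c) := by
    change Localization.mk _ _ = _
    rw [← Localization.mk_one_eq_algebraMap]
    rfl
  refine (hu.pow m).mul_left_cancel ?_
  have hl : ι (X i) ^ m * algebraMap _ _ (Away.mk 𝒜 (X_mem_one k i) m a ha) = ι a := by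
    change _ * Localization.mk _ _ = _
    rw [← map_pow]
    simp only [ι]
    rw [← Localization.mk_one_eq_algebraMap, Localization.mk_mul,
      ← Localization.mk_one_eq_algebraMap, Localization.mk_eq_mk_iff, Localization.r_iff_exists]
    exact ⟨1, by simp⟩
  rw [hl, eval₂_eq, map_sum, Finset.mul_sum]
  conv_lhs => rw [a.as_sum]
  rw [map_sum]
  refine Finset.sum_congr rfl fun d hd => ?_
  have hdeg : ∑ j, d j = m := by
    have h1 := ha
    rw [mem_homogeneousSubmodule] at h1
    have h2 := h1 (mem_support_iff.mp hd)
    rw [Finsupp.weight_apply, Finsupp.sum_fintype _ _ (by simp)] at h2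
    simpa using h2
  rw [map_mul, hconst, map_prod, monomial_eq, map_mul, Finsupp.prod_fintype _ _ (by simp),
    map_prod, mul_left_comm]
  congr 1
  rw [Finset.prod_subset (Finset.subset_univ d.support)
    (fun j _ hj => by rw [Finsupp.notMem_support_iff.mp hj, pow_zero, map_one])]
  rw [← hdeg, ← Finset.prod_pow_eq_pow_sum, ← Finset.prod_mul_distrib]
  refine Finset.prod_congr rfl fun j _ => ?_
  rw [map_pow, map_pow, ← mul_pow, hcoord]

theorem chart_hom_ext (i : Fin (n + 1)) {R : Type} [CommRing R]
    {φ ψ : Away 𝒜 (X i : MvPolynomial (Fin (n + 1)) k) →+* R}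
    (hc : φ.comp (chartConst k i) = ψ.comp (chartConst k i))
    (h : ∀ j, φ (chartCoord k i j) = ψ (chartCoord k i j)) : φ = ψ := by
  ext x
  obtain ⟨m, a, ha, rfl⟩ := Away.mk_surjective 𝒜 (X_mem_one k i) x
  rw [away_mk_eq_eval₂, hom_eval₂, hom_eval₂, hc]
  congr 1
  ext j
  exact h j

theorem chartCoord_self (i : Fin (n + 1)) : chartCoord k i i = 1 := by
  apply val_injective
  change Localization.mk _ _ = _
  rw [val_one, ← Localization.mk_one, Localization.mk_eq_mk_iff, Localization.r_iff_exists]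
  exact ⟨1, by simp⟩

/-- The chart `D₊(xᵢ)` of projective space. -/
noncomputable def chart (i : Fin (n + 1)) :
    Spec (.of (Away 𝒜 (X i : MvPolynomial (Fin (n + 1)) k))) ⟶ projectiveSpace k n :=
  Proj.awayι 𝒜 (X i) (X_mem_one k i) one_pos

instance (i : Fin (n + 1)) : IsOpenImmersion (chart k i) :=
  inferInstanceAs (IsOpenImmersion (Proj.awayι 𝒜 (X i) (X_mem_one k i) one_pos))

theorem chart_comp_projectiveSpaceHom (i : Fin (n + 1)) :
    chart k i ≫ projectiveSpaceHom k n = Spec.map (CommRingCat.ofHom (chartConst k i)) := by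
  refine (Proj.awayι_toSpecZero_assoc 𝒜 (X i) (X_mem_one k i) one_pos _).trans ?_
  rw [← Spec.map_comp]
  rfl

/-- The open set `xⱼ ≠ 0` of projective space. -/
noncomputable def coordOpen (j : Fin (n + 1)) : (projectiveSpace k n).Opens :=
  Proj.basicOpen 𝒜 (X j)

theorem range_chart (i : Fin (n + 1)) : Set.range (chart k i) = coordOpen k i :=
  congrArg (fun U : (projectiveSpace k n).Opens => (U : Set (projectiveSpace k n)))
    (Proj.opensRange_awayι 𝒜 (X i) (X_mem_one k i) one_pos)

/-- The charts cover because the variables generate the polynomial ring over its degree-zero part.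
-/
theorem exists_mem_coordOpen (x : projectiveSpace k n) : ∃ j, x ∈ coordOpen k j := by
  have h := Proj.iSup_basicOpen_eq_top' 𝒜 (fun j : Fin (n + 1) => X j)
    (fun j => ⟨1, X_mem_one k j⟩) (by
      rw [eq_top_iff]
      have h0 : Algebra.adjoin k (Set.range (X : Fin (n + 1) → MvPolynomial (Fin (n + 1)) k)) = ⊤ :=
        adjoin_range_X
      intro a _
      have ha : a ∈ Algebra.adjoin k
          (Set.range (X : Fin (n + 1) → MvPolynomial (Fin (n + 1)) k)) := h0 ▸ trivial
      induction ha using Algebra.adjoin_induction with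
      | mem x hx => exact Algebra.subset_adjoin hx
      | algebraMap r => exact Subalgebra.algebraMap_mem _ (algebraMap k (𝒜 0) r)
      | add x y _ _ hx hy => exact add_mem (hx trivial) (hy trivial)
      | mul x y _ _ hx hy => exact mul_mem (hx trivial) (hy trivial))
  have hx : x ∈ (⊤ : (Proj 𝒜).Opens) := trivial
  rw [← h] at hx
  exact TopologicalSpace.Opens.mem_iSup.mp hx

/-- On `D₊(xᵢ)` the set `xⱼ ≠ 0` is the locus where `xⱼ / xᵢ` is nonzero, and the only prime of `K`
is `0`. -/
theorem specMap_chart_mem_coordOpen (K : Type) [Field K] (i j : Fin (n + 1))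
    (φ : Away 𝒜 (X i : MvPolynomial (Fin (n + 1)) k) →+* K) (y : Spec (.of K)) :
    (Spec.map (CommRingCat.ofHom φ) ≫ chart k i) y ∈ coordOpen k j ↔ φ (chartCoord k i j) ≠ 0 := by
  have h : chart k i ⁻¹ᵁ coordOpen k j = PrimeSpectrum.basicOpen (chartCoord k i j) :=
    Proj.awayι_preimage_basicOpen 𝒜 (X_mem_one k i) one_pos (X_mem_one k j) one_pos
  have h1 : (Spec.map (CommRingCat.ofHom φ) ≫ chart k i) y ∈ coordOpen k j ↔
      Spec.map (CommRingCat.ofHom φ) y ∈ chart k i ⁻¹ᵁ coordOpen k j := Iff.rfl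
  rw [h1, h]
  have hy : (show PrimeSpectrum K from y).asIdeal = ⊥ :=
    ((Ideal.eq_bot_or_top _).resolve_right (PrimeSpectrum.isPrime _).ne_top)
  change ¬ (φ (chartCoord k i j) ∈ (show PrimeSpectrum K from y).asIdeal) ↔ _
  rw [hy, Ideal.mem_bot]

variable (K : Type) [Field K] [Algebra k K]

/-- Evaluation of functions on the chart `D₊(xᵢ)` at a vector with `i`-th coordinate `1`. -/
noncomputable def chartEval (i : Fin (n + 1)) (v : Fin (n + 1) → K) (hv : v i = 1) :
    Away 𝒜 (X i : MvPolynomial (Fin (n + 1)) k) →+* K :=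
  (Localization.awayLift (eval₂Hom (algebraMap k K) v) (X i) (by simp [hv])).comp
    (algebraMap _ (Localization.Away (X i : MvPolynomial (Fin (n + 1)) k)))

theorem isUnit_eval₂Hom_X (i : Fin (n + 1)) (v : Fin (n + 1) → K) (hv : v i = 1) :
    IsUnit (eval₂Hom (algebraMap k K) v (X i)) := by
  simp [hv]

theorem chartEval_coord (i : Fin (n + 1)) (v : Fin (n + 1) → K) (hv : v i = 1)
    (j : Fin (n + 1)) : chartEval k K i v hv (chartCoord k i j) = v j := by
  change Localization.awayLift _ _ (isUnit_eval₂Hom_X k K i v hv) (Localization.mk (X j ^ 1) ⟨X i ^ 1, _⟩) = _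
  rw [Localization.awayLift_mk (v := 1) (hv := by simp [hv])]
  simp

theorem chartEval_const (i : Fin (n + 1)) (v : Fin (n + 1) → K) (hv : v i = 1) :
    (chartEval k K i v hv).comp (chartConst k i) = algebraMap k K := by
  ext c
  change Localization.awayLift _ _ (isUnit_eval₂Hom_X k K i v hv) (Localization.mk (C c) 1) = _
  rw [Localization.mk_one_eq_algebraMap, Localization.awayLift, IsLocalization.Away.lift_eq]
  simp

/-- The vectors whose first nonzero coordinate is the `i`-th one, and equal to `1`. -/
def NormalizedVector (i : Fin (n + 1)) : Type :=
  {v : Fin (n + 1) → K // v i = 1 ∧ ∀ j < i, v j = 0}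

/-- The point of projective space with the given homogeneous coordinates. -/
noncomputable def normalizedPoint (y : Σ i : Fin (n + 1), NormalizedVector K i) :
    RationalPoints (projectiveSpaceHom k n) K :=
  ⟨Spec.map (CommRingCat.ofHom (chartEval k K y.1 y.2.1 y.2.2.1)) ≫ chart k y.1, by
    rw [Category.assoc, chart_comp_projectiveSpaceHom, ← Spec.map_comp, ← CommRingCat.ofHom_comp,
      chartEval_const]⟩

/-- The index `i` is recovered as the least `j` with the point in `D₊(xⱼ)`. On that chart the vector
is the list of values of `xⱼ / xᵢ`, which vanish for `j < i` by minimality. -/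
theorem normalizedPoint_bijective : Function.Bijective (normalizedPoint (n := n) k K) := by
  let y : Spec (.of K) := (⊥ : PrimeSpectrum K)
  constructor
  · have hlt : ∀ a b : Σ i : Fin (n + 1), NormalizedVector K i,
        normalizedPoint k K a = normalizedPoint k K b → ¬ a.1 < b.1 := by
      rintro ⟨i, v⟩ ⟨i', v'⟩ h hlt
      have h1 := specMap_chart_mem_coordOpen k K i i (chartEval k K i v.1 v.2.1) y
      have h2 := specMap_chart_mem_coordOpen k K i' i (chartEval k K i' v'.1 v'.2.1) y
      rw [chartEval_coord] at h1 h2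
      have h3 := congrArg (fun g : RationalPoints (projectiveSpaceHom k n) K =>
        g.1 y ∈ coordOpen k i) h
      have h4 := (h1.symm.trans (iff_of_eq h3)).trans h2
      rw [v.2.1, v'.2.2 i hlt] at h4
      simp at h4
    intro a b h
    have hi := le_antisymm (not_lt.mp (hlt b a h.symm)) (not_lt.mp (hlt a b h))
    obtain ⟨i, v⟩ := a
    obtain ⟨i', v'⟩ := b
    obtain rfl : i = i' := hi
    have h1 := (cancel_mono (chart k i)).mp (congrArg Subtype.val h)
    have h2 := Spec.map_injective h1
    have h3 : chartEval k K i v.1 v.2.1 = chartEval k K i v'.1 v'.2.1 :=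
      congrArg CommRingCat.Hom.hom h2
    congr 1
    refine Subtype.ext (funext fun j => ?_)
    rw [← chartEval_coord k K i v.1 v.2.1 j, h3, chartEval_coord]
  · intro g
    classical
    have hex := exists_mem_coordOpen k (g.1 y)
    let P : Fin (n + 1) → Prop := fun j => g.1 y ∈ coordOpen k j
    obtain ⟨i, hi, hmin⟩ : ∃ i, P i ∧ ∀ j < i, ¬ P j := by
      obtain ⟨i, hi, hmin⟩ := WellFounded.has_min (wellFounded_lt (α := Fin (n + 1))) {j | P j} hex
      exact ⟨i, hi, fun j hj hP => hmin j hP hj⟩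
    have hr : Set.range g.1 ⊆ Set.range (chart k i) := by
      rw [range_chart]
      rintro _ ⟨z, rfl⟩
      have : z = y := Subsingleton.elim (α := PrimeSpectrum K) z y
      rw [this]
      exact hi
    obtain ⟨φ, hφ⟩ := Spec.map_surjective (IsOpenImmersion.lift (chart k i) g.1 hr)
    have hg : Spec.map φ ≫ chart k i = g.1 := by rw [hφ, IsOpenImmersion.lift_fac]
    have hc : φ.hom.comp (chartConst k i) = algebraMap k K := by
      have h1 := g.2
      rw [← hg, Category.assoc, chart_comp_projectiveSpaceHom, ← Spec.map_comp] at h1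
      exact congrArg CommRingCat.Hom.hom (Spec.map_injective h1)
    have hv1 : φ.hom (chartCoord k i i) = 1 := by rw [chartCoord_self, map_one]
    refine ⟨⟨i, fun j => φ.hom (chartCoord k i j), hv1, fun j hj => ?_⟩, ?_⟩
    · have h1 := specMap_chart_mem_coordOpen k K i j φ.hom y
      by_contra h0
      refine hmin j hj ?_
      change g.1 y ∈ coordOpen k j
      rw [← hg]
      exact h1.mpr h0
    · refine Subtype.ext (Eq.trans ?_ hg)
      have : chartEval k K i (fun j => φ.hom (chartCoord k i j)) hv1 = φ.hom := by
        refine chart_hom_ext k i ?_ fun j => ?_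
        · rw [chartEval_const, hc]
        · rw [chartEval_coord]
      change Spec.map (CommRingCat.ofHom (chartEval k K i _ _)) ≫ chart k i = _
      rw [this]
      rfl

/-- Exactly the `n - i` coordinates after the `i`-th are free. -/
theorem natCard_normalizedVector (i : Fin (n + 1)) :
    Nat.card (NormalizedVector K i) = Nat.card K ^ (n - i) := by
  classical
  let e : NormalizedVector K i ≃ (Finset.Ioi i → K) :=
    { toFun v j := v.1 j
      invFun w := ⟨fun j => if h : i < j then w ⟨j, Finset.mem_Ioi.mpr h⟩ else
        if j = i then 1 else 0, by simp, fun j hj => by simp [hj.ne, hj.le]⟩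
      left_inv v := by
        refine Subtype.ext (funext fun j => ?_)
        rcases lt_trichotomy i j with h | rfl | h
        · simp [h]
        · simp [v.2.1]
        · simp [h.not_gt, h.ne, v.2.2 j h]
      right_inv w := by
        ext ⟨j, hj⟩
        simp [Finset.mem_Ioi.mp hj] }
  rw [Nat.card_congr e, Nat.card_fun, Nat.card_eq_fintype_card (α := Finset.Ioi i), Fintype.card_coe, Fin.card_Ioi]
  congr 1

theorem natCard_rationalPoints_projectiveSpaceHom [Finite K] :
    Nat.card (RationalPoints (projectiveSpaceHom k n) K) =
      ∑ i ∈ Finset.range (n + 1), Nat.card K ^ i := by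
  have (i : Fin (n + 1)) : Finite (NormalizedVector K i) :=
    inferInstanceAs (Finite {v : Fin (n + 1) → K // v i = 1 ∧ ∀ j < i, v j = 0})
  rw [← Nat.card_congr (Equiv.ofBijective _ (normalizedPoint_bijective k K)), Nat.card_sigma]
  simp only [natCard_normalizedVector]
  rw [Fin.sum_univ_eq_sum_range (fun i => Nat.card K ^ (n - i)),
    ← Finset.sum_range_reflect (fun i => Nat.card K ^ i)]
  simp

end ProjectiveSpace

end ZetaEntropy

/-! ### The three entropy formulas -/

open ZetaEntropy in
theorem lemma6p2p3 (p : ℕ) [Fact p.Prime] (k : Type) [Field k] [Finite k] [CharP k p]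
    (q : ℕ) (hq : q = Nat.card k) :
    -- the point `Spec 𝔽_q`
    (∀ s : ℝ, 0 < s →
      HasShannonEntropyAt p (𝟙 (Spec (.of k))) s ∧
      DifferentiableAt ℝ (fun u : ℝ => Real.log (1 - (q : ℝ) ^ (-u))) s ∧
      shannonEntropy p (𝟙 (Spec (.of k))) s =
        -oneSubEuler (fun u : ℝ => Real.log (1 - (q : ℝ) ^ (-u))) s ∧
      (PhysicalSystem.ofLevels (fun j => j * Real.log q) (fun _ => 1)).HasEntropyAt s ∧
      shannonEntropy p (𝟙 (Spec (.of k))) s =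
        (PhysicalSystem.ofLevels (fun j => j * Real.log q) (fun _ => 1)).entropy s) ∧
    -- affine space
    (∀ (n : ℕ) (s : ℝ), (n : ℝ) < s →
      HasShannonEntropyAt p (affineSpaceHom k n) s ∧
      DifferentiableAt ℝ (fun u : ℝ => Real.log (1 - (q : ℝ) ^ ((n : ℝ) - u))) s ∧
      shannonEntropy p (affineSpaceHom k n) s =
        -oneSubEuler (fun u : ℝ => Real.log (1 - (q : ℝ) ^ ((n : ℝ) - u))) s ∧
      (PhysicalSystem.ofLevels (fun j => j * Real.log q) (fun j => q ^ (j * n))).HasEntropyAt s ∧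
      shannonEntropy p (affineSpaceHom k n) s =
        (PhysicalSystem.ofLevels (fun j => j * Real.log q) (fun j => q ^ (j * n))).entropy s) ∧
    -- projective space
    (∀ (n : ℕ) (s : ℝ), (n : ℝ) < s →
      HasShannonEntropyAt p (projectiveSpaceHom k n) s ∧
      DifferentiableAt ℝ
        (fun u : ℝ => ∑ i ∈ Finset.range (n + 1), Real.log (1 - (q : ℝ) ^ ((i : ℝ) - u))) s ∧
      shannonEntropy p (projectiveSpaceHom k n) s =
        -oneSubEuler
          (fun u : ℝ => ∑ i ∈ Finset.range (n + 1), Real.log (1 - (q : ℝ) ^ ((i : ℝ) - u))) s ∧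
      (PhysicalSystem.composite fun i : Fin (n + 1) =>
        PhysicalSystem.ofLevels (fun j => j * Real.log q) (fun j => q ^ (j * (i : ℕ)))).HasEntropyAt
          s ∧
      shannonEntropy p (projectiveSpaceHom k n) s =
        (PhysicalSystem.composite fun i : Fin (n + 1) =>
          PhysicalSystem.ofLevels (fun j => j * Real.log q)
            (fun j => q ^ (j * (i : ℕ)))).entropy s) := by
  subst hq
  have hq : 1 < Nat.card k := Finite.one_lt_card
  have hq' : (1 : ℝ) < Nat.card k := by exact_mod_cast hq
  have hexp {i : ℕ} {u : ℝ} (h : (i : ℝ) < u) :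
      (1 - (Nat.card k : ℝ) ^ ((i : ℝ) - u))⁻¹ =
        Real.exp (-Real.log (1 - (Nat.card k : ℝ) ^ ((i : ℝ) - u))) := by
    rw [Real.exp_neg, Real.exp_log (one_sub_rpow_pos hq' h)]
  have hext (m : ℕ) : Nat.card (FiniteField.Extension k p (m + 1)) = Nat.card k ^ (m + 1) :=
    FiniteField.natCard_extension k p (m + 1)
  refine ⟨fun s hs => ?_, fun n s hs => ?_, fun n s hs => ?_⟩
  · have hs' : ((0 : ℕ) : ℝ) < s := by simpa using hs
    obtain ⟨h1, h2⟩ := shannonEntropy_of_card p (𝟙 (Spec (.of k))) (I := {0})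
      (Finset.singleton_nonempty 0)
      (fun m => by rw [natCard_rationalPoints_id]; simp) le_rfl (by simp) hs
    have hd : DifferentiableAt ℝ (fun u : ℝ => Real.log (1 - (Nat.card k : ℝ) ^ (-u))) s := by
      simpa using differentiableAt_log_one_sub_rpow hq' hs
    obtain ⟨h3, h4⟩ := PhysicalSystem.hasEntropyAt_of_hasSum hs hd fun u hu => by
      have hu' : ((0 : ℕ) : ℝ) < u := by simpa using hu
      have := PhysicalSystem.hasSum_ofLevels hq 0 hu'
      rw [hexp hu'] at this
      -- The non-degenerate system is the case `n = 0` of degeneracies `q ^ (j * n)`.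
      simpa only [mul_zero, pow_zero, Nat.cast_zero, zero_sub] using this
    have hg : logInvZeta (Nat.card k) {0} =
        fun u : ℝ => Real.log (1 - (Nat.card k : ℝ) ^ (-u)) := by
      ext u; simp [logInvZeta]
    rw [hg] at h2
    exact ⟨h1, hd, h2, h3, h2.trans h4.symm⟩
  · obtain ⟨h1, h2⟩ := shannonEntropy_of_card p (affineSpaceHom k n) (I := {n})
      (Finset.singleton_nonempty n)
      (fun m => by
        rw [natCard_rationalPoints_affineSpaceHom, hext, Finset.sum_singleton, ← pow_mul, mul_comm])
      n.cast_nonneg (by simp) hs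
    have hd := differentiableAt_log_one_sub_rpow hq' hs
    obtain ⟨h3, h4⟩ := PhysicalSystem.hasEntropyAt_of_hasSum hs hd fun u hu => by
      have := PhysicalSystem.hasSum_ofLevels hq n hu
      rwa [hexp hu] at this
    have hg : logInvZeta (Nat.card k) {n} =
        fun u : ℝ => Real.log (1 - (Nat.card k : ℝ) ^ ((n : ℝ) - u)) := by
      ext u; simp [logInvZeta]
    rw [hg] at h2
    exact ⟨h1, hd, h2, h3, h2.trans h4.symm⟩
  · have hle (i : ℕ) (hi : i ∈ Finset.range (n + 1)) : (i : ℝ) ≤ n := by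
      exact_mod_cast Nat.lt_succ_iff.mp (Finset.mem_range.mp hi)
    obtain ⟨h1, h2⟩ := shannonEntropy_of_card p (projectiveSpaceHom k n) (I := Finset.range (n + 1))
      Finset.nonempty_range_add_one
      (fun m => by
        rw [natCard_rationalPoints_projectiveSpaceHom, hext]
        simp only [← pow_mul, mul_comm])
      n.cast_nonneg hle hs
    have hd := differentiableAt_logInvZeta hq (I := Finset.range (n + 1))
      fun i hi => (hle i hi).trans_lt hs
    obtain ⟨h3, h4⟩ := PhysicalSystem.hasEntropyAt_of_hasSum
      (Y := PhysicalSystem.composite fun i : Fin (n + 1) =>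
        PhysicalSystem.ofLevels (fun j => j * Real.log (Nat.card k))
          (fun j => Nat.card k ^ (j * (i : ℕ)))) hs hd fun u hu => by
      have hu' (i : Fin (n + 1)) : ((i : ℕ) : ℝ) < u :=
        (hle i (Finset.mem_range.mpr i.2)).trans_lt hu
      have := PhysicalSystem.hasSum_composite
        fun i : Fin (n + 1) => PhysicalSystem.hasSum_ofLevels hq (i : ℕ) (hu' i)
      simp only [hexp (hu' _)] at this
      -- Independence becomes additivity of `log Z`: the product of the `n + 1` partition functions
      -- is the exponential of minus the sum of logarithms.
      rwa [← Real.exp_sum, Finset.sum_neg_distrib, Fin.sum_univ_eq_sum_range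
        (fun i : ℕ => Real.log (1 - (Nat.card k : ℝ) ^ ((i : ℝ) - u)))] at this
    exact ⟨h1, hd, h2, h3, h2.trans h4.symm⟩
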